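/- **Theorem (Ohno's relation).** Let $m\ge 1$ and let $k_1,l_1,\dots,k_m,l_m$ be nonnegative integers with $k_1\ge 1$ and $l_m\ge 1$. Put $L_0=0$ and $L_i=l_1+\dots+l_i$, and for $\lambda\in\mathbb C\setminus\{1,2,3,\dots\}$ define $$f(\{k_i,l_i\}_{i=1}^m;\lambda)=\sum_{n_1>\dots>n_{L_m}>0}\ \prod_{i=1}^m\frac{1}{n_{L_{i-1}+1}^{k_i}\,(n_{L_{i-1}+1}-\lambda)(n_{L_{i-1}+2}-\lambda)\cdots(n_{L_i}-\lambda)},$$ where the $i$-th factor contains exactly $l_i$ linear factors in $\lambda$ (none if $l_i=0$). Let $g(\{k_i,l_i\}_{i=1}^m;\lambda)=f(\{k'_i,l'_i\}_{i=1}^m;\lambda)$ be the same function for the dual sequence $k'_i=l_{m+1-i}$, $l'_i=k_{m+1-i}$ (this corresponds to the anti-involution $\tau$, $x\mapsto y$, $y\mapsto x$, acting on the word $x^{k_1}y^{l_1}\cdots x^{k_m}y^{l_m}$). Then: 1. For every $\lambda\in\mathbb C\setminus\{1,2,3,\dots\}$ both series converge absolutely, and $$f(\{k_i,l_i\}_{i=1}^m;\lambda)=g(\{k_i,l_i\}_{i=1}^m;\lambda).$$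 2. Equivalently, on the level of coefficients, let $s=(s_1,\dots,s_{L_m})$ be the index with $s_j=1+\sum_{i:\,L_{i-1}=j-1}k_i$ (so that $s=(k_1+1,\underbrace{1,\dots,1}_{l_1-1},\dots,k_m+1,\underbrace{1,\dots,1}_{l_m-1})$ if all $k_i,l_i\ge1$), and let $s'=(s'_1,\dots,s'_{r'})$, $r'=k_1+\dots+k_m$, be the index obtained in the same way from the dual sequence. For $s$ (with $r=L_m$) and for $s'$ (with $r'$ in place of $r$), all multiple zeta values $\zeta(s_1+\epsilon_1,\dots,s_r+\epsilon_r)=\sum_{n_1>\dots>n_r>0}\prod_j n_j^{-s_j-\epsilon_j}$ with integers $\epsilon_j\ge0$ converge. For $|\lambda|<1$, $$f(\{k_i,l_i\}_{i=1}^m;\lambda)=\sum_{w=0}^\infty\Bigl(\sum_{\substack{\epsilon_1,\dots,\epsilon_r\ge0\\ \epsilon_1+\dots+\epsilon_r=w}}\zeta(s_1+\epsilon_1,\dots,s_r+\epsilon_r)\Bigr)\lambda^w,$$ and likewise for $g$ with $s'$. Hence, for every integer $w\ge0$, $$\sum_{\substack{\epsilon_1,\dots,\epsilon_r\ge0\\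 \epsilon_1+\dots+\epsilon_r=w}}\zeta(s_1+\epsilon_1,\dots,s_r+\epsilon_r)=\sum_{\substack{\epsilon'_1,\dots,\epsilon'_{r'}\ge0\\ \epsilon'_1+\dots+\epsilon'_{r'}=w}}\zeta(s'_1+\epsilon'_1,\dots,s'_{r'}+\epsilon'_{r'}).$$ -/

import Mathlib

open scoped BigOperators

namespace OhnoRelation

/-- Strictly decreasing sequences `n_1 > n_2 > ⋯ > n_r > 0` of positive integers
(the variables are numbered from `0`: `n_{j+1}` is `n j`). -/
abbrev DecSeq (r : ℕ) : Type := {n : Fin r → ℕ // StrictAnti n ∧ ∀ j, 0 < n j}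

/-- The general term `1 / (n_1^{s_1} ⋯ n_r^{s_r})` of a multiple zeta value. -/
noncomputable def mzvTerm {r : ℕ} (s : Fin r → ℕ) (n : DecSeq r) : ℝ :=
  ∏ j, 1 / (n.1 j : ℝ) ^ s j

/-- The multiple zeta value `ζ(s_1, …, s_r) = ∑_{n_1 > ⋯ > n_r > 0} 1 / (n_1^{s_1} ⋯ n_r^{s_r})`. -/
noncomputable def mzv {r : ℕ} (s : Fin r → ℕ) : ℝ := ∑' n : DecSeq r, mzvTerm s n

/-- `L_i = l_1 + ⋯ + l_i` (with `L_0 = 0`). -/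
def partialLen {m : ℕ} (l : Fin m → ℕ) (i : ℕ) : ℕ :=
  ∑ j with j.val < i, l j

/-- The entry `n_{j+1}` of a sequence of length `r`. The value `1` for `j ≥ r` is a placeholder: it
is never reached in `fTerm` when the last `l_i` is positive. -/
def entry {r : ℕ} (n : Fin r → ℕ) (j : ℕ) : ℕ :=
  if h : j < r then n ⟨j, h⟩ else 1

/-- The general term
`∏_i 1 / (n_{L_{i-1}+1}^{k_i} (n_{L_{i-1}+1} - lam) ⋯ (n_{L_i} - lam))`, where the product of the
linear factors has `l_i` factors (it is empty if `l_i = 0`). -/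
noncomputable def fTerm {m : ℕ} (k l : Fin m → ℕ) (lam : ℂ) (n : DecSeq (∑ i, l i)) : ℂ :=
  ∏ i : Fin m,
    1 / ((entry n.1 (partialLen l i.val) : ℂ) ^ k i *
      ∏ j ∈ Finset.Ico (partialLen l i.val) (partialLen l (i.val + 1)),
        ((entry n.1 j : ℂ) - lam))

/-- The generating function `f({k_i, l_i}; lam)`. -/
noncomputable def f {m : ℕ} (k l : Fin m → ℕ) (lam : ℂ) : ℂ :=
  ∑' n : DecSeq (∑ i, l i), fTerm k l lam n

/-- The anti-involution `τ` (`x ↦ y`, `y ↦ x`) sends the word `x^{k_1} y^{l_1} ⋯ x^{k_m} y^{l_m}` to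
`x^{l_m} y^{k_m} ⋯ x^{l_1} y^{k_1}`: the `x`-exponents of the dual are the reversed `l_i`. -/
def dualK {m : ℕ} (_k l : Fin m → ℕ) : Fin m → ℕ := fun i => l i.rev

/-- The `y`-exponents of the `τ`-dual are the reversed `k_i`. -/
def dualL {m : ℕ} (k _l : Fin m → ℕ) : Fin m → ℕ := fun i => k i.rev

/-- The generating function `g({k_i, l_i}; lam)`: the function `f` of the `τ`-dual index. -/
noncomputable def g {m : ℕ} (k l : Fin m → ℕ) (lam : ℂ) : ℂ :=
  f (dualK k l) (dualL k l) lam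

/-- The index of the multiple zeta value attached to the word `x^{k_1} y^{l_1} ⋯ x^{k_m} y^{l_m}`:
the entry belonging to a letter `y` is one plus the number of letters `x` immediately in front of
it. If all `k_i, l_i ≥ 1`, this is `(k_1 + 1, 1, …, 1, …, k_m + 1, 1, …, 1)`, with `l_i - 1` ones
after `k_i + 1`. -/
def zetaIndex {m : ℕ} (k l : Fin m → ℕ) (j : Fin (∑ i, l i)) : ℕ :=
  1 + ∑ i with partialLen l i.val = j.val, k i

/-- `∑_{ε_1 + ⋯ + ε_r = w} ζ(s_1 + ε_1, …, s_r + ε_r)`, over nonnegative integers `ε_j`. -/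
noncomputable def ohnoSum {r : ℕ} (s : Fin r → ℕ) (w : ℕ) : ℝ :=
  ∑ ε ∈ Finset.Nat.antidiagonalTuple r w, mzv (s + ε)

end OhnoRelation

/-!
The proof follows the method of connected sums. To a word in letters `x` and `y` one attaches a
nested sum in which `x` contributes a factor `1 / n` and `y` opens a new summation index `n` with a
factor `1 / (n - lam)`; the word `x^{k_1} y^{l_1} ⋯ x^{k_m} y^{l_m}` yields `f`
(`wordSum_indexWord`, `blockWord_eq_indexWord`, `fTerm_eq_nestedTerm`). The nested sums of two words are coupled by the
connector `C(n, m) = (1 - lam)_n (1 - lam)_m / (1 - lam)_{n + m}`. Since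
`1 / (a - lam) * C(n, a) = 1 / n * (C(n, a - 1) - C(n, a))`, telescoping gives
`1 / n * C(n, m) = ∑_{a > m} 1 / (a - lam) * C(n, a)`, so an outermost `x` on one side may be
exchanged for an outermost `y` on the other (`connectedSum_cons_true`). Carrying all letters across
replaces the word by its dual (`wordSum_dualWord`).

For real `lam < 1` all terms are nonnegative, and the argument runs in `[0, ∞]` without any
convergence question. It even supplies the convergence needed later: for `lam = 0` it identifies
`ζ(2, 1, …, 1)` with a value of the Riemann zeta function (`tsum_weightTerm_single_ne_top`), and
`ζ(2, 1, …, 1)` dominates all other series through the bound `|n - lam| ≥ c n`, which holds locally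
uniformly in `lam` off the positive integers. Both sides are therefore holomorphic there, and the
identity extends from the real interval by the identity theorem (`tsum_nestedTerm_eq_of_real`).
Expanding each `1 / (n - lam)` as a geometric series gives the power series at the origin
(`hasSum_ohnoSum`), and the uniqueness of its coefficients gives the relation between multiple zeta
values.
-/

namespace OhnoRelation

open scoped ENNReal
open Filter Topology

/-! ### The connector -/

/-- The shifted factorial `(1 - lam) (2 - lam) ⋯ (n - lam)`. -/
noncomputable def shiftedFactorial (lam : ℝ) (n : ℕ) : ℝ :=
  ∏ i ∈ Finset.range n, ((i : ℝ) + 1 - lam)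

/-- The connector `C(n, m) = (1 - lam)_n (1 - lam)_m / (1 - lam)_{n + m}`, which couples the two
halves of a connected sum. -/
noncomputable def connector (lam : ℝ) (n m : ℕ) : ℝ :=
  shiftedFactorial lam n * shiftedFactorial lam m / shiftedFactorial lam (n + m)

section Connector

variable {lam : ℝ}

lemma shiftedFactorial_succ (lam : ℝ) (n : ℕ) :
    shiftedFactorial lam (n + 1) = shiftedFactorial lam n * ((n : ℝ) + 1 - lam) :=
  Finset.prod_range_succ _ _

lemma natCast_add_one_sub_pos (h : lam < 1) (n : ℕ) : 0 < (n : ℝ) + 1 - lam := by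
  have : (0 : ℝ) ≤ n := n.cast_nonneg
  linarith

lemma shiftedFactorial_pos (h : lam < 1) (n : ℕ) : 0 < shiftedFactorial lam n :=
  Finset.prod_pos fun i _ => natCast_add_one_sub_pos h i

lemma connector_pos (h : lam < 1) (n m : ℕ) : 0 < connector lam n m :=
  div_pos (mul_pos (shiftedFactorial_pos h n) (shiftedFactorial_pos h m))
    (shiftedFactorial_pos h _)

lemma connector_comm (lam : ℝ) (n m : ℕ) : connector lam n m = connector lam m n := by
  rw [connector, connector, add_comm, mul_comm (shiftedFactorial lam n)]

lemma connector_zero_right (h : lam < 1) (n : ℕ) : connector lam n 0 = 1 := by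
  rw [connector, add_zero, show shiftedFactorial lam 0 = 1 from Finset.prod_range_zero _, mul_one,
    div_self (shiftedFactorial_pos h n).ne']

lemma connector_succ_left (h : lam < 1) (n m : ℕ) :
    connector lam (n + 1) m
      = connector lam n m * (((n : ℝ) + 1 - lam) / (((n + m : ℕ) : ℝ) + 1 - lam)) := by
  have h1 := (shiftedFactorial_pos h (n + m)).ne'
  have h2 := (natCast_add_one_sub_pos h (n + m)).ne'
  rw [connector, connector, shiftedFactorial_succ, show n + 1 + m = (n + m) + 1 by ring,
    shiftedFactorial_succ]
  field_simp

lemma connector_le_one (h : lam < 1) (n m : ℕ) : connector lam n m ≤ 1 := by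
  induction n with
  | zero => rw [connector_comm, connector_zero_right h]
  | succ n ih =>
    rw [connector_succ_left h]
    have h2 := natCast_add_one_sub_pos h (n + m)
    refine mul_le_one₀ ih (div_nonneg (natCast_add_one_sub_pos h n).le h2.le) ?_
    rw [div_le_one h2]
    push_cast
    have : (0 : ℝ) ≤ m := m.cast_nonneg
    linarith

lemma tendsto_connector (h : lam < 1) {n : ℕ} (hn : 0 < n) :
    Tendsto (connector lam n) atTop (𝓝 0) := by
  obtain ⟨n, rfl⟩ := Nat.exists_eq_succ_of_ne_zero hn.ne'
  have hlim : Tendsto (fun m : ℕ => ((n : ℝ) + 1 - lam) / (((n + m : ℕ) : ℝ) + 1 - lam))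
      atTop (𝓝 0) := by
    refine Tendsto.div_atTop tendsto_const_nhds ?_
    have : Tendsto (fun m : ℕ => (m : ℝ) + (n + 1 - lam)) atTop atTop :=
      tendsto_atTop_add_const_right _ _ tendsto_natCast_atTop_atTop
    refine this.congr fun m => ?_
    push_cast
    ring
  refine squeeze_zero (fun m => (connector_pos h _ m).le) (fun m => ?_) hlim
  rw [Nat.succ_eq_add_one, connector_succ_left h]
  exact mul_le_of_le_one_left (div_nonneg (natCast_add_one_sub_pos h n).le
    (natCast_add_one_sub_pos h _).le) (connector_le_one h n m)

/-- The difference equation that makes the sums over one argument of the connector telescope. -/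
lemma connector_sub_connector_succ (h : lam < 1) {n : ℕ} (hn : 0 < n) (a : ℕ) :
    1 / (((a + 1 : ℕ) : ℝ) - lam) * connector lam n (a + 1)
      = 1 / (n : ℝ) * connector lam n a - 1 / (n : ℝ) * connector lam n (a + 1) := by
  have h1 := (shiftedFactorial_pos h (n + a)).ne'
  have h2 := (natCast_add_one_sub_pos h (n + a)).ne'
  have h3 := (natCast_add_one_sub_pos h a).ne'
  have h4 : (n : ℝ) ≠ 0 := by exact_mod_cast hn.ne'
  rw [connector, connector, shiftedFactorial_succ, show n + (a + 1) = (n + a) + 1 by ring,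
    shiftedFactorial_succ]
  push_cast at *
  field_simp
  ring

lemma hasSum_connector (h : lam < 1) {n : ℕ} (hn : 0 < n) (m : ℕ) :
    HasSum (fun i : ℕ => 1 / (((i + m + 1 : ℕ) : ℝ) - lam) * connector lam n (i + m + 1))
      (1 / (n : ℝ) * connector lam n m) := by
  have hpos : ∀ i : ℕ, 0 ≤ 1 / (((i + m + 1 : ℕ) : ℝ) - lam) * connector lam n (i + m + 1) := by
    intro i
    have := natCast_add_one_sub_pos h (i + m)
    push_cast at this ⊢
    exact mul_nonneg (one_div_nonneg.2 this.le) (connector_pos h _ _).le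
  rw [hasSum_iff_tendsto_nat_of_nonneg hpos]
  have hpart : ∀ N : ℕ, ∑ i ∈ Finset.range N,
      1 / (((i + m + 1 : ℕ) : ℝ) - lam) * connector lam n (i + m + 1)
      = 1 / (n : ℝ) * connector lam n m - 1 / (n : ℝ) * connector lam n (N + m) := by
    intro N
    simp only [connector_sub_connector_succ h hn]
    have := Finset.sum_range_sub' (fun i => 1 / (n : ℝ) * connector lam n (i + m)) N
    simp only [zero_add] at this
    rw [← this]
    exact Finset.sum_congr rfl fun i _ => by rw [show i + 1 + m = i + m + 1 by ring]
  simp only [hpart]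
  have := ((tendsto_connector h hn).comp (tendsto_add_atTop_nat m)).const_mul (1 / (n : ℝ))
  simpa using this.const_sub (1 / (n : ℝ) * connector lam n m)

end Connector

/-! ### Connected sums of words and their transport -/

/-- The weight `1 / n` of a letter `x`, with value `0` at `n = 0`. -/
noncomputable def xWeight (n : ℕ) : ℝ≥0∞ := ENNReal.ofReal (1 / (n : ℝ))

/-- The weight `1 / (n - lam)` of a letter `y`. -/
noncomputable def yWeight (lam : ℝ) (n : ℕ) : ℝ≥0∞ := ENNReal.ofReal (1 / ((n : ℝ) - lam))

/-- The part with largest index `N` of the nested sum attached to a word in the letters `x`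
(`true`) and `y` (`false`). The first letter of the word is the outermost one: `x` multiplies by
`1 / N`, while `y` opens a new summation index `N`, with weight `1 / (N - lam)`. The empty word has
the single summation index `0`. -/
noncomputable def wordCoeff (lam : ℝ) : List Bool → ℕ → ℝ≥0∞
  | [], N => if N = 0 then 1 else 0
  | true :: w, N => xWeight N * wordCoeff lam w N
  | false :: w, N => yWeight lam N * ∑' b, if b < N then wordCoeff lam w b else 0

/-- The nested sum attached to a word. -/
noncomputable def wordSum (lam : ℝ) (w : List Bool) : ℝ≥0∞ := ∑' N, wordCoeff lam w N

/-- The connected sum of two words. -/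
noncomputable def connectedSum (lam : ℝ) (u v : List Bool) : ℝ≥0∞ :=
  ∑' n, ∑' m, wordCoeff lam u n * ENNReal.ofReal (connector lam n m) * wordCoeff lam v m

/-- The anti-involution on words that exchanges `x` and `y`. -/
def dualWord (w : List Bool) : List Bool := (w.map not).reverse

section Transport

variable {lam : ℝ}

lemma wordCoeff_zero_of_ne_nil {w : List Bool} (hw : w ≠ []) : wordCoeff lam w 0 = 0 := by
  match w, hw with
  | true :: w, _ => simp [wordCoeff, xWeight]
  | false :: w, _ => simp [wordCoeff]

lemma connectedSum_comm (u v : List Bool) : connectedSum lam u v = connectedSum lam v u := by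
  rw [connectedSum, ENNReal.tsum_comm, connectedSum]
  refine tsum_congr fun n => tsum_congr fun m => ?_
  rw [connector_comm]
  ring

lemma tsum_yWeight_mul_connector (h : lam < 1) {n : ℕ} (hn : 0 < n) (m : ℕ) :
    ∑' a, (if m < a then yWeight lam a * ENNReal.ofReal (connector lam n a) else 0)
      = xWeight n * ENNReal.ofReal (connector lam n m) := by
  have hinj : Function.Injective (fun i : ℕ => i + m + 1) := fun a b hab => by simpa using hab
  rw [← hinj.tsum_eq]
  · have hs := hasSum_connector h hn m
    rw [xWeight, ← ENNReal.ofReal_mul (by positivity), ← hs.tsum_eq,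
      ENNReal.ofReal_tsum_of_nonneg _ hs.summable]
    · refine tsum_congr fun i => ?_
      rw [if_pos (by omega), yWeight, ENNReal.ofReal_mul]
      have := natCast_add_one_sub_pos h (i + m)
      push_cast at this ⊢
      exact one_div_nonneg.2 this.le
    · intro i
      have := natCast_add_one_sub_pos h (i + m)
      push_cast at this ⊢
      exact mul_nonneg (one_div_nonneg.2 this.le) (connector_pos h _ _).le
  · intro a ha
    have hma : m < a := by
      by_contra hma
      simp [hma] at ha
    exact ⟨a - m - 1, by simp only; omega⟩

/-- Transport of a letter: an outermost `x` on the left becomes an outermost `y` on the right. -/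
lemma connectedSum_cons_true (h : lam < 1) {u : List Bool} (hu : u ≠ []) (v : List Bool) :
    connectedSum lam (true :: u) v = connectedSum lam u (false :: v) := by
  rw [connectedSum, connectedSum]
  refine tsum_congr fun n => ?_
  -- The telescoping identity needs `n > 0`; at `n = 0` both sides vanish because `u` is nonempty.
  rcases Nat.eq_zero_or_pos n with rfl | hn
  · simp [wordCoeff, wordCoeff_zero_of_ne_nil hu]
  calc ∑' m, wordCoeff lam (true :: u) n * ENNReal.ofReal (connector lam n m) * wordCoeff lam v m
      = ∑' m, ∑' a, wordCoeff lam u n * wordCoeff lam v m *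
          (if m < a then yWeight lam a * ENNReal.ofReal (connector lam n a) else 0) := by
        refine tsum_congr fun m => ?_
        rw [ENNReal.tsum_mul_left, tsum_yWeight_mul_connector h hn, wordCoeff]
        ring
    _ = ∑' a, ∑' m, wordCoeff lam u n * ENNReal.ofReal (connector lam n a) * yWeight lam a *
          (if m < a then wordCoeff lam v m else 0) := by
        rw [ENNReal.tsum_comm]
        refine tsum_congr fun a => tsum_congr fun m => ?_
        split_ifs
        · ring
        · simp
    _ = _ := by
        refine tsum_congr fun a => ?_
        rw [ENNReal.tsum_mul_left, wordCoeff]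
        ring

lemma connectedSum_cons_false (h : lam < 1) (u : List Bool) {v : List Bool} (hv : v ≠ []) :
    connectedSum lam (false :: u) v = connectedSum lam u (true :: v) := by
  rw [connectedSum_comm, ← connectedSum_cons_true h hv, connectedSum_comm]

lemma connectedSum_nil_right (h : lam < 1) (w : List Bool) :
    connectedSum lam w [] = wordSum lam w := by
  refine tsum_congr fun n => ?_
  rw [tsum_eq_single 0 fun m hm => by simp [wordCoeff, hm]]
  simp [wordCoeff, connector_zero_right h]

/-- Carrying all letters of `u` to the right-hand side, one at a time, appends the dual of `u`. -/
lemma connectedSum_eq_nil_dualWord (h : lam < 1) (u v : List Bool)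
    (hu : ∀ hne : u ≠ [], u.getLast hne = false)
    (huv : v ≠ [] ∨ ∀ hne : u ≠ [], u.head hne = true) :
    connectedSum lam u v = connectedSum lam [] (dualWord u ++ v) := by
  induction u generalizing v with
  | nil => rfl
  | cons c u ih =>
    have hu' : ∀ hne : u ≠ [], u.getLast hne = false := fun hne => by
      simpa [List.getLast_cons hne] using hu (by simp)
    have hdual : dualWord (c :: u) ++ v = dualWord u ++ ((!c) :: v) := by simp [dualWord]
    rw [hdual, ← ih ((!c) :: v) hu' (Or.inl (by simp))]
    cases c with
    | true =>
      refine connectedSum_cons_true h (fun hne => ?_) v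
      subst hne
      simpa using hu (by simp)
    | false =>
      refine connectedSum_cons_false h u (huv.resolve_right fun hc => ?_)
      simpa using hc (by simp)

/-- Ohno's relation on the level of words, with values in `[0, ∞]` so that no convergence has to be
known beforehand. -/
theorem wordSum_dualWord (h : lam < 1) (w : List Bool)
    (hfirst : ∀ hne : w ≠ [], w.head hne = true) (hlast : ∀ hne : w ≠ [], w.getLast hne = false) :
    wordSum lam (dualWord w) = wordSum lam w := by
  rw [← connectedSum_nil_right h w, connectedSum_eq_nil_dualWord h w [] hlast (Or.inr hfirst),
    connectedSum_comm, List.append_nil, connectedSum_nil_right h]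

end Transport

/-! ### Nested sums over decreasing sequences -/

/-- The word `x^{t_1} y x^{t_2} y ⋯ x^{t_r} y`. -/
def indexWord {r : ℕ} (t : Fin r → ℕ) : List Bool :=
  (List.ofFn fun j => List.replicate (t j) true ++ [false]).flatten

/-- The general term `∏_j 1 / (n_j^{t_j} (n_j - lam))`, for real `lam < 1` and with values in
`[0, ∞]`. -/
noncomputable def weightTerm {r : ℕ} (lam : ℝ) (t : Fin r → ℕ) (n : DecSeq r) : ℝ≥0∞ :=
  ∏ j, (xWeight (n.1 j) ^ t j * yWeight lam (n.1 j))

/-- The largest entry of a decreasing sequence, with value `0` for the empty sequence. -/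
def DecSeq.top : {r : ℕ} → DecSeq r → ℕ
  | 0, _ => 0
  | _ + 1, n => n.1 0

lemma DecSeq.le_top {r : ℕ} (n : DecSeq r) (j : Fin r) : n.1 j ≤ n.top := by
  cases r with
  | zero => exact j.elim0
  | succ r => exact n.2.1.antitone (Fin.zero_le j)

/-- A nonempty decreasing sequence consists of its largest entry and a shorter decreasing sequence
below it. -/
def DecSeq.consEquiv (r : ℕ) : {q : ℕ × DecSeq r // q.2.top < q.1} ≃ DecSeq (r + 1) where
  toFun q := ⟨Fin.cons q.1.1 q.1.2.1, by
    obtain ⟨⟨N, n⟩, h⟩ := q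
    simp only at h
    refine ⟨fun i j hij => ?_, fun j => ?_⟩
    · cases j using Fin.cases with
      | zero => simp at hij
      | succ j =>
        cases i using Fin.cases with
        | zero => simpa using (n.le_top j).trans_lt h
        | succ i => simpa using n.2.1 (Fin.succ_lt_succ_iff.1 hij)
    · cases j using Fin.cases with
      | zero => simpa using (Nat.zero_le _).trans_lt h
      | succ j => simpa using n.2.2 j⟩
  invFun n := ⟨(n.1 0, ⟨Fin.tail n.1, fun _ _ hij => n.2.1 (Fin.succ_lt_succ_iff.2 hij),
      fun j => n.2.2 j.succ⟩), by
    cases r with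
    | zero => exact n.2.2 0
    | succ r => exact n.2.1 (Fin.succ_pos 0)⟩
  left_inv q := by simp
  right_inv n := by simp

lemma tsum_decSeq_succ {r : ℕ} (F : DecSeq (r + 1) → ℝ≥0∞) (G : ℕ → DecSeq r → ℝ≥0∞)
    (h : ∀ q, F (DecSeq.consEquiv r q) = G q.1.1 q.1.2) :
    ∑' n, F n = ∑' N, ∑' n : DecSeq r, if n.top < N then G N n else 0 := by
  rw [← (DecSeq.consEquiv r).tsum_eq, tsum_congr h]
  refine (tsum_subtype {q : ℕ × DecSeq r | q.2.top < q.1} fun q => G q.1 q.2).trans ?_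
  rw [ENNReal.tsum_prod']
  exact tsum_congr fun N => tsum_congr fun n => by simp [Set.indicator_apply]

lemma wordCoeff_replicate_true_append (lam : ℝ) (a : ℕ) (w : List Bool) (N : ℕ) :
    wordCoeff lam (List.replicate a true ++ w) N = xWeight N ^ a * wordCoeff lam w N := by
  induction a with
  | zero => simp
  | succ a ih =>
    rw [List.replicate_succ, List.cons_append, wordCoeff, ih, pow_succ]
    ring

lemma indexWord_succ {r : ℕ} (t : Fin (r + 1) → ℕ) :
    indexWord t = List.replicate (t 0) true ++ false :: indexWord (Fin.tail t) := by
  simp [indexWord, List.ofFn_succ, Fin.tail]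

/-- The nested sum with largest index `N` runs over the decreasing sequences with first entry
`N`. -/
lemma wordCoeff_indexWord (lam : ℝ) {r : ℕ} (t : Fin r → ℕ) (N : ℕ) :
    wordCoeff lam (indexWord t) N
      = ∑' n : DecSeq r, if n.top = N then weightTerm lam t n else 0 := by
  induction r generalizing N with
  | zero =>
    have : Unique (DecSeq 0) :=
      ⟨⟨⟨Fin.elim0, fun i => i.elim0, fun i => i.elim0⟩⟩, fun n => Subsingleton.elim _ _⟩
    rw [tsum_eq_single default fun n hn => (hn (Subsingleton.elim _ _)).elim]
    simp [indexWord, wordCoeff, weightTerm, DecSeq.top, eq_comm]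
  | succ r ih =>
    rw [indexWord_succ, wordCoeff_replicate_true_append, wordCoeff,
      tsum_decSeq_succ _ (fun M n => if M = N then
        xWeight M ^ t 0 * yWeight lam M * weightTerm lam (Fin.tail t) n else 0)]
    · have hinner : ∑' b, (if b < N then wordCoeff lam (indexWord (Fin.tail t)) b else 0)
          = ∑' n : DecSeq r, if n.top < N then weightTerm lam (Fin.tail t) n else 0 := by
        calc _ = ∑' b, ∑' n : DecSeq r, if n.top = b then
              (if n.top < N then weightTerm lam (Fin.tail t) n else 0) else 0 := by
              refine tsum_congr fun b => ?_
              rw [ih]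
              split_ifs with hb
              · refine tsum_congr fun n => ?_
                split_ifs with h1 h2 <;> first | rfl | (exfalso; omega)
              · symm
                rw [ENNReal.tsum_eq_zero]
                intro n
                split_ifs with h1 h2 <;> first | rfl | (exfalso; omega)
          _ = _ := by
              rw [ENNReal.tsum_comm]
              refine tsum_congr fun n => ?_
              rw [tsum_eq_single n.top fun b hb => by simp [hb.symm]]
              simp
      rw [hinner, tsum_eq_single (f := fun M => ∑' n : DecSeq r, if n.top < M then _ else 0) N
        fun M hM => by simp [hM], ← mul_assoc, ← ENNReal.tsum_mul_left]
      refine tsum_congr fun n => ?_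
      by_cases hn : n.top < N <;> simp [hn]
    · rintro ⟨⟨M, n⟩, h⟩
      generalize hc : DecSeq.consEquiv r ⟨(M, n), h⟩ = c
      have h0 : c.1 0 = M := by rw [← hc]; rfl
      have hs : ∀ i : Fin r, c.1 i.succ = n.1 i := fun i => by rw [← hc]; rfl
      simp [h0, hs, DecSeq.top, weightTerm, Fin.prod_univ_succ, Fin.tail]

lemma wordSum_indexWord (lam : ℝ) {r : ℕ} (t : Fin r → ℕ) :
    wordSum lam (indexWord t) = ∑' n : DecSeq r, weightTerm lam t n := by
  simp only [wordSum, wordCoeff_indexWord]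
  rw [ENNReal.tsum_comm]
  refine tsum_congr fun n => ?_
  rw [tsum_eq_single n.top fun b hb => by simp [hb.symm]]
  simp

/-! ### The word of an index -/

/-- The word `x^{k_1} y^{l_1} ⋯ x^{k_m} y^{l_m}`. -/
def blockWord {m : ℕ} (k l : Fin m → ℕ) : List Bool :=
  (List.ofFn fun i => List.replicate (k i) true ++ List.replicate (l i) false).flatten

/-- The number of letters `x` of the word `x^{k_1} y^{l_1} ⋯ x^{k_m} y^{l_m}` that stand between
its `j`-th and its `(j + 1)`-st letter `y`. -/
def xExponent {m : ℕ} (k l : Fin m → ℕ) (j : ℕ) : ℕ :=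
  ∑ i with partialLen l i.val = j, k i

lemma blockWord_succ_last {m : ℕ} (k l : Fin (m + 1) → ℕ) :
    blockWord k l = blockWord (Fin.init k) (Fin.init l)
      ++ (List.replicate (k (Fin.last m)) true ++ List.replicate (l (Fin.last m)) false) := by
  rw [blockWord, List.ofFn_succ', List.concat_eq_append, List.flatten_append,
    List.flatten_singleton]
  rfl

lemma dualWord_blockWord {m : ℕ} (k l : Fin m → ℕ) :
    dualWord (blockWord k l) = blockWord (dualK k l) (dualL k l) := by
  induction m with
  | zero => simp [dualWord, blockWord]
  | succ m ih =>
    have h1 : blockWord k l = List.replicate (k 0) true ++ List.replicate (l 0) false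
        ++ blockWord (Fin.tail k) (Fin.tail l) := by
      simp [blockWord, List.ofFn_succ, Fin.tail]
    rw [h1, blockWord_succ_last (dualK k l)]
    have h3 : dualWord (blockWord (Fin.tail k) (Fin.tail l))
        = blockWord (Fin.init (dualK k l)) (Fin.init (dualL k l)) := by
      rw [ih]
      congr 1
      · ext i; simp [dualK, Fin.tail, Fin.init, Fin.rev_castSucc]
      · ext i; simp [dualL, Fin.tail, Fin.init, Fin.rev_castSucc]
    rw [← h3]
    simp [dualWord, dualK, dualL]

section PartialLen

variable {m : ℕ} (l : Fin m → ℕ)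

lemma partialLen_zero : partialLen l 0 = 0 := by simp [partialLen]

lemma partialLen_succ (i : Fin m) : partialLen l (i.val + 1) = partialLen l i.val + l i := by
  have : (Finset.univ.filter fun j : Fin m => j.val < i.val + 1)
      = insert i (Finset.univ.filter fun j : Fin m => j.val < i.val) := by
    ext j
    simp [Fin.ext_iff]
    omega
  rw [partialLen, this, Finset.sum_insert (by simp), add_comm, partialLen]

lemma partialLen_mono : Monotone (partialLen l) := fun _ _ hab =>
  Finset.sum_le_sum_of_subset fun j hj => by
    simp only [Finset.mem_filter, Finset.mem_univ, true_and] at hj ⊢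
    omega

lemma partialLen_self : partialLen l m = ∑ i, l i := by
  rw [partialLen, Finset.filter_true_of_mem fun j _ => j.isLt]

end PartialLen

lemma partialLen_init {m : ℕ} (l : Fin (m + 1) → ℕ) {i : ℕ} (hi : i ≤ m) :
    partialLen (Fin.init l) i = partialLen l i := by
  rw [partialLen, partialLen, Finset.sum_filter, Finset.sum_filter, Fin.sum_univ_castSucc]
  simp [Fin.init, hi]

lemma partialLen_lt_sum {m : ℕ} (l : Fin (m + 1) → ℕ) (hl : 1 ≤ l (Fin.last m)) (i : Fin (m + 1)) :
    partialLen l i.val < ∑ i, l i := by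
  have h1 := partialLen_succ l (Fin.last m)
  have h2 := partialLen_mono l (Nat.le_of_lt_succ i.isLt)
  have h3 := partialLen_self l
  simp only [Fin.val_last] at h1
  omega

/-- The part of `x^{T_0} y x^{T_1} y ⋯` up to its `L`-th letter `y`. -/
def prefixWord (T : ℕ → ℕ) (L : ℕ) : List Bool :=
  ((List.range L).map fun j => List.replicate (T j) true ++ [false]).flatten

lemma prefixWord_succ (T : ℕ → ℕ) (L : ℕ) :
    prefixWord T (L + 1) = prefixWord T L ++ (List.replicate (T L) true ++ [false]) := by
  simp [prefixWord, List.range_succ]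

lemma prefixWord_congr {T T' : ℕ → ℕ} {L : ℕ} (h : ∀ j < L, T j = T' j) :
    prefixWord T L = prefixWord T' L := by
  rw [prefixWord, prefixWord]
  congr 1
  refine List.map_congr_left fun j hj => ?_
  rw [h j (List.mem_range.1 hj)]

lemma prefixWord_append_replicate_false (T : ℕ → ℕ) (L a : ℕ) (hT : ∀ j, L < j → T j = 0) :
    prefixWord T L ++ List.replicate (T L) true ++ List.replicate a false
      = prefixWord T (L + a) ++ List.replicate (T (L + a)) true := by
  induction a with
  | zero => simp
  | succ a ih =>
    rw [List.replicate_succ', ← List.append_assoc, ih, ← add_assoc, prefixWord_succ,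
      hT (L + a + 1) (by omega)]
    simp

/-- Reading off the runs of `x` between consecutive `y`s. Without a condition on the last `l_i` the
word may end with letters `x`; neighbouring blocks `x^{k_i}` merge where `l_i = 0`. -/
lemma blockWord_eq_prefixWord {m : ℕ} (k l : Fin m → ℕ) :
    blockWord k l = prefixWord (xExponent k l) (∑ i, l i)
      ++ List.replicate (xExponent k l (∑ i, l i)) true := by
  induction m with
  | zero => simp [blockWord, prefixWord, xExponent]
  | succ m ih =>
    have hsum : ∑ i, l i = (∑ i, Fin.init l i) + l (Fin.last m) := Fin.sum_univ_castSucc _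
    have hX : ∀ j, xExponent k l j = xExponent (Fin.init k) (Fin.init l) j
        + if ∑ i, Fin.init l i = j then k (Fin.last m) else 0 := by
      intro j
      simp only [xExponent, Finset.sum_filter]
      rw [Fin.sum_univ_castSucc, ← partialLen_self (Fin.init l), partialLen_init l le_rfl]
      congr 1
      refine Finset.sum_congr rfl fun i _ => ?_
      rw [partialLen_init l i.isLt.le]
      rfl
    have hX0 : ∀ j, ∑ i, Fin.init l i < j → xExponent k l j = 0 := by
      intro j hj
      refine Finset.sum_eq_zero fun i hi => ?_
      have h1 := (Finset.mem_filter.1 hi).2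
      have h2 := partialLen_mono l (Nat.le_of_lt_succ i.isLt)
      rw [← partialLen_self (Fin.init l), partialLen_init l le_rfl] at hj
      omega
    rw [hsum, ← prefixWord_append_replicate_false _ _ _ hX0, blockWord_succ_last, ih,
      hX (∑ i, Fin.init l i), if_pos rfl, List.replicate_add,
      prefixWord_congr (T := xExponent k l) (T' := xExponent (Fin.init k) (Fin.init l))
        fun j hj => by rw [hX, if_neg hj.ne', add_zero]]
    simp only [List.append_assoc]

lemma blockWord_eq_indexWord {m : ℕ} (k l : Fin (m + 1) → ℕ) (hl : 1 ≤ l (Fin.last m)) :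
    blockWord k l = indexWord fun j : Fin (∑ i, l i) => xExponent k l j := by
  have h0 : xExponent k l (∑ i, l i) = 0 := by
    refine Finset.sum_eq_zero fun i hi => ?_
    have h1 := (Finset.mem_filter.1 hi).2
    have h2 := partialLen_lt_sum l hl i
    omega
  rw [blockWord_eq_prefixWord, h0, prefixWord, indexWord, List.ofFn_eq_map,
    ← List.map_coe_finRange_eq_range, List.map_map]
  simp [Function.comp_def]

lemma blockWord_head {m : ℕ} (k l : Fin (m + 1) → ℕ) (hk : 1 ≤ k 0)
    (hne : blockWord k l ≠ []) : (blockWord k l).head hne = true := by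
  obtain ⟨a, ha⟩ := Nat.exists_eq_succ_of_ne_zero (Nat.one_le_iff_ne_zero.1 hk)
  simp [blockWord, List.ofFn_succ, ha, List.replicate_succ]

lemma blockWord_getLast {m : ℕ} (k l : Fin (m + 1) → ℕ) (hl : 1 ≤ l (Fin.last m))
    (hne : blockWord k l ≠ []) : (blockWord k l).getLast hne = false := by
  obtain ⟨a, ha⟩ := Nat.exists_eq_succ_of_ne_zero (Nat.one_le_iff_ne_zero.1 hl)
  simp [blockWord_succ_last, ha, List.replicate_succ']

lemma one_le_dualK_zero {m : ℕ} (k l : Fin (m + 1) → ℕ) (hl : 1 ≤ l (Fin.last m)) :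
    1 ≤ dualK k l 0 := by
  simpa [dualK] using hl

lemma one_le_dualL_last {m : ℕ} (k l : Fin (m + 1) → ℕ) (hk : 1 ≤ k 0) :
    1 ≤ dualL k l (Fin.last m) := by
  simpa [dualL] using hk

/-- Ohno's relation for real `lam < 1`, with values in `[0, ∞]`. -/
theorem tsum_weightTerm_dual {lam : ℝ} (h : lam < 1) {m : ℕ} (k l : Fin (m + 1) → ℕ)
    (hk : 1 ≤ k 0) (hl : 1 ≤ l (Fin.last m)) :
    ∑' n : DecSeq (∑ i, dualL k l i),
        weightTerm lam (fun j => xExponent (dualK k l) (dualL k l) j) n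
      = ∑' n : DecSeq (∑ i, l i), weightTerm lam (fun j => xExponent k l j) n := by
  rw [← wordSum_indexWord, ← wordSum_indexWord, ← blockWord_eq_indexWord k l hl,
    ← blockWord_eq_indexWord _ _ (one_le_dualL_last k l hk), ← dualWord_blockWord]
  exact wordSum_dualWord h _ (blockWord_head k l hk) (blockWord_getLast k l hl)

/-! ### The general term as a product over the summation indices -/

/-- The term `∏_j 1 / (n_j^{t_j} (n_j - lam))`. -/
noncomputable def nestedTerm {r : ℕ} (t : Fin r → ℕ) (lam : ℂ) (n : DecSeq r) : ℂ :=
  ∏ j, 1 / ((n.1 j : ℂ) ^ t j * ((n.1 j : ℂ) - lam))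

lemma prod_prod_Ico_partialLen {m : ℕ} (l : Fin m → ℕ) (G : ℕ → ℂ) :
    ∏ i : Fin m, ∏ j ∈ Finset.Ico (partialLen l i.val) (partialLen l (i.val + 1)), G j
      = ∏ j ∈ Finset.range (∑ i, l i), G j := by
  rw [Fin.prod_univ_eq_prod_range (fun i => ∏ j ∈ Finset.Ico (partialLen l i)
    (partialLen l (i + 1)), G j) m, ← partialLen_self l]
  have : ∀ a, ∏ i ∈ Finset.range a, ∏ j ∈ Finset.Ico (partialLen l i) (partialLen l (i + 1)), G j
      = ∏ j ∈ Finset.range (partialLen l a), G j := by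
    intro a
    induction a with
    | zero => simp [partialLen_zero]
    | succ a ih =>
      rw [Finset.prod_range_succ, ih,
        Finset.prod_range_mul_prod_Ico _ (partialLen_mono l (Nat.le_succ a))]
  exact this m

lemma fTerm_eq_nestedTerm {m : ℕ} (k l : Fin (m + 1) → ℕ) (hl : 1 ≤ l (Fin.last m)) (lam : ℂ)
    (n : DecSeq (∑ i, l i)) :
    fTerm k l lam n = nestedTerm (fun j => xExponent k l j) lam n := by
  have hentry : ∀ j : Fin (∑ i, l i), entry n.1 j = n.1 j := fun j => by simp [entry]
  rw [fTerm, nestedTerm]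
  simp only [one_div, Finset.prod_inv_distrib, Finset.prod_mul_distrib]
  rw [prod_prod_Ico_partialLen l fun j => ((entry n.1 j : ℂ) - lam), Finset.prod_range]
  simp only [hentry]
  congr 2
  have hfib := Finset.prod_fiberwise Finset.univ
    (fun i : Fin (m + 1) => (⟨partialLen l i.val, partialLen_lt_sum l hl i⟩ : Fin (∑ i, l i)))
    (fun i => (entry n.1 (partialLen l i.val) : ℂ) ^ k i)
  rw [← hfib]
  refine Finset.prod_congr rfl fun j _ => ?_
  rw [xExponent, ← Finset.prod_pow_eq_pow_sum]
  simp only [Fin.ext_iff]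
  refine Finset.prod_congr rfl fun i hi => ?_
  rw [(Finset.mem_filter.1 hi).2, hentry]

lemma nestedTerm_ofReal {lam : ℝ} (h : lam < 1) {r : ℕ} (t : Fin r → ℕ) (n : DecSeq r) :
    nestedTerm t lam n = ((weightTerm lam t n).toReal : ℂ) := by
  rw [nestedTerm, weightTerm, ENNReal.toReal_prod, Complex.ofReal_prod]
  refine Finset.prod_congr rfl fun j _ => ?_
  have hn : (1 : ℝ) ≤ n.1 j := by exact_mod_cast n.2.2 j
  rw [ENNReal.toReal_mul, ENNReal.toReal_pow, xWeight, yWeight,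
    ENNReal.toReal_ofReal (by positivity),
    ENNReal.toReal_ofReal (one_div_nonneg.2 (by linarith))]
  push_cast
  rw [one_div_pow, one_div_mul_one_div]

lemma mzvTerm_nonneg {r : ℕ} (s : Fin r → ℕ) (n : DecSeq r) : 0 ≤ mzvTerm s n :=
  Finset.prod_nonneg fun _ _ => by positivity

/-! ### Convergence -/

/-- The series for `ζ(r + 2)` converges. -/
lemma wordSum_indexWord_one_ne_top (r : ℕ) :
    wordSum 0 (indexWord fun _ : Fin 1 => r + 1) ≠ ∞ := by
  have hle : ∀ N, wordCoeff 0 (indexWord fun _ : Fin 1 => r + 1) N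
      ≤ ENNReal.ofReal (1 / (N : ℝ) ^ 2) := by
    intro N
    rw [indexWord_succ, wordCoeff_replicate_true_append, wordCoeff]
    rcases Nat.eq_zero_or_pos N with rfl | hN
    · simp
    have hx : xWeight N ≤ 1 := by
      have : (1 : ℝ) ≤ N := by exact_mod_cast hN
      rw [xWeight, ENNReal.ofReal_le_one]
      exact div_le_one_of_le₀ this (by positivity)
    have hinner : ∑' b, (if b < N then
        wordCoeff 0 (indexWord (Fin.tail fun _ : Fin 1 => r + 1)) b else 0) = 1 := by
      rw [tsum_eq_single 0 fun b hb => by simp [indexWord, wordCoeff, hb]]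
      simp [indexWord, wordCoeff, hN]
    rw [hinner, mul_one, yWeight, sub_zero, ← xWeight, pow_succ, mul_assoc]
    calc xWeight N ^ r * (xWeight N * xWeight N) ≤ 1 * (xWeight N * xWeight N) := by
          gcongr
          exact pow_le_one₀ (zero_le) hx
      _ = _ := by
          rw [one_mul, xWeight, ← ENNReal.ofReal_mul (by positivity)]
          congr 1
          field_simp
  refine ne_top_of_le_ne_top ?_ (ENNReal.tsum_le_tsum hle)
  rw [← ENNReal.ofReal_tsum_of_nonneg (fun _ => by positivity)
    (Real.summable_one_div_nat_pow.2 one_lt_two)]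
  exact ENNReal.ofReal_ne_top

/-- Convergence of `ζ(2, 1, …, 1)`, which by duality equals `ζ(r + 2)`. -/
lemma tsum_weightTerm_single_ne_top (r : ℕ) :
    ∑' n : DecSeq (r + 1), weightTerm 0 (Pi.single 0 1) n ≠ ∞ := by
  have hw : indexWord (Pi.single 0 1 : Fin (r + 1) → ℕ)
      = true :: List.replicate (r + 1) false := by
    have htail : ∀ r : ℕ, indexWord (fun _ : Fin r => 0) = List.replicate r false := by
      intro r
      induction r with
      | zero => rfl
      | succ r ih => rw [indexWord_succ, List.replicate_succ, ← ih]; rfl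
    rw [indexWord_succ, List.replicate_succ, ← htail r]
    simp only [Pi.single_eq_same, List.replicate_one, List.cons_append, List.nil_append]
    congr 3
  rw [← wordSum_indexWord, ← wordSum_dualWord zero_lt_one, hw]
  · have hd : dualWord (true :: List.replicate (r + 1) false)
        = indexWord fun _ : Fin 1 => r + 1 := by
      simp [dualWord, indexWord]
    rw [hd]
    exact wordSum_indexWord_one_ne_top r
  · simp [hw]
  · intro hne
    simp [hw, List.replicate_succ']

lemma summable_mzvTerm {r : ℕ} (s : Fin (r + 1) → ℕ) (h0 : 2 ≤ s 0) (hs : ∀ j, 1 ≤ s j) :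
    Summable (mzvTerm s) := by
  refine Summable.of_nonneg_of_le (mzvTerm_nonneg s) (fun n => ?_)
    (ENNReal.summable_toReal (tsum_weightTerm_single_ne_top r))
  rw [weightTerm, ENNReal.toReal_prod]
  refine Finset.prod_le_prod (fun j _ => by positivity) fun j _ => ?_
  have hn : (1 : ℝ) ≤ n.1 j := by exact_mod_cast n.2.2 j
  rw [ENNReal.toReal_mul, ENNReal.toReal_pow, xWeight, yWeight, sub_zero,
    ENNReal.toReal_ofReal (by positivity), ← pow_succ, one_div_pow]
  refine one_div_le_one_div_of_le (by positivity) (pow_le_pow_right₀ hn ?_)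
  rcases eq_or_ne j 0 with rfl | hj
  · simpa using h0
  · simpa [hj] using hs j

/-- Off the positive integers, `|n - lam|` is bounded below by a multiple of `n`, locally uniformly
in `lam`. -/
lemma exists_mul_le_norm_natCast_sub (lam : ℂ) (h : ∀ p : ℕ, 0 < p → lam ≠ (p : ℂ)) :
    ∃ c : ℝ, 0 < c ∧ ∀ z ∈ Metric.ball lam c, ∀ n : ℕ, 0 < n → c * n ≤ ‖(n : ℂ) - z‖ := by
  have hfin : ∀ N : ℕ, ∃ c : ℝ, 0 < c ∧ ∀ n : ℕ, 0 < n → n ≤ N → c * n ≤ ‖(n : ℂ) - lam‖ := by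
    intro N
    induction N with
    | zero => exact ⟨1, one_pos, fun n h1 h2 => by omega⟩
    | succ N ih =>
      obtain ⟨c, hc, hcN⟩ := ih
      have hpos : 0 < ‖((N + 1 : ℕ) : ℂ) - lam‖ :=
        norm_pos_iff.2 (sub_ne_zero.2 (h (N + 1) N.succ_pos).symm)
      have hN : (0 : ℝ) < (N + 1 : ℕ) := by positivity
      refine ⟨min c (‖((N + 1 : ℕ) : ℂ) - lam‖ / (N + 1 : ℕ)), lt_min hc (div_pos hpos hN),
        fun n h1 h2 => ?_⟩
      rcases Nat.lt_or_ge N n with h3 | h3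
      · obtain rfl : n = N + 1 := by omega
        calc _ ≤ ‖((N + 1 : ℕ) : ℂ) - lam‖ / (N + 1 : ℕ) * (N + 1 : ℕ) := by
              gcongr; exact min_le_right _ _
          _ = _ := div_mul_cancel₀ _ hN.ne'
      · refine le_trans ?_ (hcN n h1 h3)
        gcongr
        exact min_le_left _ _
  -- For `n ≥ 2 |lam|` the constant `1 / 2` works; only finitely many `n` remain.
  obtain ⟨N, hN⟩ := exists_nat_ge (2 * ‖lam‖)
  obtain ⟨c, hc, hcN⟩ := hfin N
  have hall : ∀ n : ℕ, 0 < n → min c (1 / 2) * n ≤ ‖(n : ℂ) - lam‖ := by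
    intro n hn
    rcases Nat.lt_or_ge N n with h3 | h3
    · have h4 : (N : ℝ) < n := by exact_mod_cast h3
      have h5 := norm_sub_norm_le (n : ℂ) lam
      rw [Complex.norm_natCast] at h5
      calc min c (1 / 2) * n ≤ 1 / 2 * n := by gcongr; exact min_le_right _ _
        _ ≤ _ := by linarith
    · refine le_trans ?_ (hcN n hn h3)
      gcongr
      exact min_le_left _ _
  have hc2 : 0 < min c (1 / 2) := lt_min hc (by norm_num)
  refine ⟨min c (1 / 2) / 2, by positivity, fun z hz n hn => ?_⟩
  have h1 : (1 : ℝ) ≤ n := by exact_mod_cast hn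
  have h2 := hall n hn
  have h3 : ‖z - lam‖ < min c (1 / 2) / 2 := by simpa [dist_eq_norm] using hz
  have h4 : ‖(n : ℂ) - lam‖ ≤ ‖(n : ℂ) - z‖ + ‖z - lam‖ := norm_sub_le_norm_sub_add_norm_sub ..
  nlinarith

lemma norm_nestedTerm_le {r : ℕ} (t : Fin r → ℕ) {c : ℝ} (hc : 0 < c) {lam : ℂ}
    (h : ∀ n : ℕ, 0 < n → c * n ≤ ‖(n : ℂ) - lam‖) (n : DecSeq r) :
    ‖nestedTerm t lam n‖ ≤ (c⁻¹) ^ r * mzvTerm (fun j => 1 + t j) n := by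
  rw [nestedTerm, norm_prod, mzvTerm]
  calc _ ≤ ∏ j, c⁻¹ * (1 / (n.1 j : ℝ) ^ (1 + t j)) := by
        refine Finset.prod_le_prod (fun j _ => norm_nonneg _) fun j _ => ?_
        have hn : (0 : ℝ) < n.1 j := by exact_mod_cast n.2.2 j
        rw [norm_div, norm_one, norm_mul, norm_pow, Complex.norm_natCast, inv_eq_one_div,
          one_div_mul_one_div]
        refine one_div_le_one_div_of_le (by positivity) ?_
        calc c * (n.1 j : ℝ) ^ (1 + t j) = (n.1 j : ℝ) ^ t j * (c * n.1 j) := by ring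
          _ ≤ _ := by gcongr; exact h _ (n.2.2 j)
    _ = _ := by rw [Finset.prod_mul_distrib]; simp

lemma summable_nestedTerm {r : ℕ} (t : Fin (r + 1) → ℕ) (h0 : 1 ≤ t 0) {lam : ℂ}
    (h : ∀ p : ℕ, 0 < p → lam ≠ (p : ℂ)) : Summable (nestedTerm t lam) := by
  obtain ⟨c, hc, hcn⟩ := exists_mul_le_norm_natCast_sub lam h
  refine Summable.of_norm_bounded ((summable_mzvTerm (fun j => 1 + t j) (by omega)
    fun j => by omega).mul_left ((c⁻¹) ^ (r + 1))) fun n => ?_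
  exact norm_nestedTerm_le t hc (hcn lam (Metric.mem_ball_self hc)) n

/-! ### Analytic continuation -/

lemma differentiableAt_tsum_nestedTerm {r : ℕ} (t : Fin (r + 1) → ℕ) (h0 : 1 ≤ t 0) {lam : ℂ}
    (h : ∀ p : ℕ, 0 < p → lam ≠ (p : ℂ)) :
    DifferentiableAt ℂ (fun z => ∑' n, nestedTerm t z n) lam := by
  obtain ⟨c, hc, hcn⟩ := exists_mul_le_norm_natCast_sub lam h
  have hd : DifferentiableOn ℂ (fun z => ∑' n, nestedTerm t z n) (Metric.ball lam c) := by
    refine Complex.differentiableOn_tsum_of_summable_norm ((summable_mzvTerm (fun j => 1 + t j)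
      (by omega) fun j => by omega).mul_left ((c⁻¹) ^ (r + 1))) (fun n => ?_) Metric.isOpen_ball
      fun n z hz => norm_nestedTerm_le t hc (hcn z hz) n
    refine DifferentiableOn.fun_finsetProd fun j _ => ?_
    refine DifferentiableOn.div (by fun_prop) (by fun_prop) fun z hz => ?_
    have hn : (0 : ℝ) < n.1 j := by exact_mod_cast n.2.2 j
    refine mul_ne_zero (pow_ne_zero _ (by exact_mod_cast hn.ne')) ?_
    exact norm_pos_iff.1 (lt_of_lt_of_le (by positivity) (hcn z hz _ (n.2.2 j)))
  exact hd.differentiableAt (Metric.ball_mem_nhds lam hc)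

/-- Two of the series that agree on `[0, 1)` agree off the positive integers. -/
lemma tsum_nestedTerm_eq_of_real {r r' : ℕ} (t : Fin (r + 1) → ℕ) (t' : Fin (r' + 1) → ℕ)
    (h0 : 1 ≤ t 0) (h0' : 1 ≤ t' 0)
    (heq : ∀ x : ℝ, x < 1 → ∑' n, nestedTerm t x n = ∑' n, nestedTerm t' x n) {lam : ℂ}
    (h : ∀ p : ℕ, 0 < p → lam ≠ (p : ℂ)) :
    ∑' n, nestedTerm t lam n = ∑' n, nestedTerm t' lam n := by
  set S : Set ℂ := Set.range fun p : ℕ => ((p + 1 : ℕ) : ℂ) with hS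
  have hmem : ∀ z : ℂ, z ∈ Sᶜ ↔ ∀ p : ℕ, 0 < p → z ≠ (p : ℂ) := by
    intro z
    refine ⟨fun hz p hp hzp => hz ⟨p - 1, ?_⟩, ?_⟩
    · simp only [Nat.sub_add_cancel hp, hzp]
    · rintro hz ⟨p, rfl⟩
      exact hz (p + 1) p.succ_pos rfl
  have hopen : IsOpen Sᶜ := by
    rw [isOpen_iff_mem_nhds]
    intro z hz
    obtain ⟨c, hc, hcn⟩ := exists_mul_le_norm_natCast_sub z ((hmem z).1 hz)
    refine Filter.mem_of_superset (Metric.ball_mem_nhds z hc) fun y hy => (hmem y).2 ?_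
    rintro p hp rfl
    have h1 := hcn _ hy p hp
    have h2 : (0 : ℝ) < p := by exact_mod_cast hp
    rw [sub_self, norm_zero] at h1
    nlinarith
  have hconn : IsPreconnected Sᶜ :=
    ((Set.countable_range _).isPathConnected_compl_of_one_lt_rank
      (by rw [Complex.rank_real_complex]; norm_num)).isConnected.isPreconnected
  have hA : ∀ {r : ℕ} (t : Fin (r + 1) → ℕ), 1 ≤ t 0 →
      AnalyticOnNhd ℂ (fun z => ∑' n, nestedTerm t z n) Sᶜ := fun t h0 =>
    DifferentiableOn.analyticOnNhd (fun z hz =>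
      (differentiableAt_tsum_nestedTerm t h0 ((hmem z).1 hz)).differentiableWithinAt) hopen
  have hzero : (0 : ℂ) ∈ Sᶜ := (hmem 0).2 fun p hp hp0 => by
    have : p = 0 := by exact_mod_cast hp0.symm
    omega
  have hfreq : ∃ᶠ z in 𝓝[≠] (0 : ℂ), ∑' n, nestedTerm t z n = ∑' n, nestedTerm t' z n := by
    have htend : Tendsto (fun j : ℕ => (((1 : ℝ) / ((j : ℝ) + 2) : ℝ) : ℂ)) atTop (𝓝[≠] 0) := by
      refine tendsto_nhdsWithin_iff.2 ⟨?_, Eventually.of_forall fun j => ?_⟩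
      · rw [← Complex.ofReal_zero]
        refine (Complex.continuous_ofReal.tendsto 0).comp ?_
        exact tendsto_const_nhds.div_atTop
          (tendsto_atTop_add_const_right _ _ tendsto_natCast_atTop_atTop)
      · have : (1 : ℝ) / ((j : ℝ) + 2) ≠ 0 := by positivity
        exact Complex.ofReal_ne_zero.2 this
    refine htend.frequently (Frequently.of_forall fun j => heq _ ?_)
    rw [div_lt_one (by positivity)]
    have : (0 : ℝ) ≤ j := j.cast_nonneg
    linarith
  exact (hA t h0).eqOn_of_preconnected_of_frequently_eq (hA t' h0') hconn hzero hfreq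
    ((hmem lam).2 h)

/-! ### Expansion at the origin -/

lemma sum_antidiagonalTuple_succ {M : Type*} [AddCommMonoid M] (r w : ℕ)
    (F : (Fin (r + 1) → ℕ) → M) :
    ∑ ε ∈ Finset.Nat.antidiagonalTuple (r + 1) w, F ε
      = ∑ p ∈ Finset.HasAntidiagonal.antidiagonal w, ∑ ε ∈ Finset.Nat.antidiagonalTuple r p.2,
          F (Fin.cons p.1 ε) := by
  rw [Finset.sum_sigma']
  refine Finset.sum_bij' (fun ε _ => ⟨(ε 0, ∑ j, Fin.tail ε j), Fin.tail ε⟩)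
    (fun x _ => Fin.cons x.1.1 x.2) ?_ ?_ ?_ ?_ ?_
  · intro ε hε
    rw [Finset.Nat.mem_antidiagonalTuple, Fin.sum_univ_succ] at hε
    simpa [Finset.Nat.mem_antidiagonalTuple, Fin.tail] using hε
  · rintro ⟨⟨a, b⟩, ε⟩ hε
    simp only [Finset.mem_sigma, Finset.HasAntidiagonal.mem_antidiagonal,
      Finset.Nat.mem_antidiagonalTuple] at hε
    simp [Finset.Nat.mem_antidiagonalTuple, Fin.sum_univ_succ, hε.2, hε.1]
  · intro ε _
    simp
  · rintro ⟨⟨a, b⟩, ε⟩ hε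
    simp only [Finset.mem_sigma, Finset.HasAntidiagonal.mem_antidiagonal,
      Finset.Nat.mem_antidiagonalTuple] at hε
    simp [hε.2]
  · intro ε _
    simp

/-- The Cauchy product of finitely many absolutely convergent series. -/
lemma hasSum_antidiagonalTuple_prod {r : ℕ} (a : Fin r → ℕ → ℂ) (A : Fin r → ℂ)
    (ha : ∀ j, Summable fun e => ‖a j e‖) (hA : ∀ j, HasSum (a j) (A j)) :
    (Summable fun w => ‖∑ ε ∈ Finset.Nat.antidiagonalTuple r w, ∏ j, a j (ε j)‖) ∧
      HasSum (fun w => ∑ ε ∈ Finset.Nat.antidiagonalTuple r w, ∏ j, a j (ε j)) (∏ j, A j) := by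
  induction r with
  | zero =>
    have h1 : ∀ w : ℕ, w ≠ 0 →
        ∑ ε ∈ Finset.Nat.antidiagonalTuple 0 w, ∏ j, a j (ε j) = 0 := by
      intro w hw
      obtain ⟨w, rfl⟩ := Nat.exists_eq_succ_of_ne_zero hw
      simp
    constructor
    · exact summable_of_ne_finset_zero (s := {0}) fun w hw => by
        rw [h1 w (by simpa using hw), norm_zero]
    · have := hasSum_single 0 h1
      simpa using this
  | succ r ih =>
    obtain ⟨ih1, ih2⟩ := ih (fun j => a j.succ) (fun j => A j.succ) (fun j => ha _) fun j => hA _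
    have hexp : ∀ w, ∑ ε ∈ Finset.Nat.antidiagonalTuple (r + 1) w, ∏ j, a j (ε j)
        = ∑ p ∈ Finset.HasAntidiagonal.antidiagonal w, a 0 p.1 *
            ∑ ε ∈ Finset.Nat.antidiagonalTuple r p.2, ∏ j, a j.succ (ε j) := by
      intro w
      rw [sum_antidiagonalTuple_succ]
      refine Finset.sum_congr rfl fun p _ => ?_
      rw [Finset.mul_sum]
      refine Finset.sum_congr rfl fun ε _ => ?_
      simp [Fin.prod_univ_succ]
    have hs := summable_norm_sum_mul_antidiagonal_of_summable_norm (ha 0) ih1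
    simp only [hexp]
    refine ⟨hs, ?_⟩
    rw [Fin.prod_univ_succ, ← (hA 0).tsum_eq, ← ih2.tsum_eq,
      tsum_mul_tsum_eq_tsum_sum_antidiagonal_of_summable_norm (ha 0) ih1]
    exact hs.of_norm.hasSum

lemma hasSum_nestedTerm {r : ℕ} (t : Fin r → ℕ) {lam : ℂ} (h : ‖lam‖ < 1) (n : DecSeq r) :
    HasSum (fun w : ℕ => ((∑ ε ∈ Finset.Nat.antidiagonalTuple r w,
      mzvTerm ((fun j => 1 + t j) + ε) n : ℝ) : ℂ) * lam ^ w) (nestedTerm t lam n) := by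
  have hn1 : ∀ j, (1 : ℝ) ≤ n.1 j := fun j => by exact_mod_cast n.2.2 j
  have hn0 : ∀ j, (n.1 j : ℂ) ≠ 0 := fun j => by exact_mod_cast (n.2.2 j).ne'
  have hlt : ∀ j, ‖lam / (n.1 j : ℂ)‖ < 1 := by
    intro j
    rw [norm_div, Complex.norm_natCast]
    exact (div_le_self (norm_nonneg _) (hn1 j)).trans_lt h
  have hgeom : ∀ j, HasSum (fun e : ℕ => 1 / (n.1 j : ℂ) ^ (1 + t j) * (lam / n.1 j) ^ e)
      (1 / ((n.1 j : ℂ) ^ t j * ((n.1 j : ℂ) - lam))) := by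
    intro j
    have := (hasSum_geometric_of_norm_lt_one (hlt j)).mul_left (1 / (n.1 j : ℂ) ^ (1 + t j))
    have h1 := hn0 j
    have h2 : (n.1 j : ℂ) - lam ≠ 0 := by
      intro h2
      have := hlt j
      rw [← sub_eq_zero.1 h2, div_self h1, norm_one] at this
      exact lt_irrefl _ this
    have h3 : 1 - lam / (n.1 j : ℂ) = ((n.1 j : ℂ) - lam) / n.1 j := by field_simp
    have h4 : 1 / (n.1 j : ℂ) ^ (1 + t j) * (1 - lam / (n.1 j : ℂ))⁻¹
        = 1 / ((n.1 j : ℂ) ^ t j * ((n.1 j : ℂ) - lam)) := by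
      rw [h3, pow_add]
      field_simp
    rwa [h4] at this
  have hnorm : ∀ j, Summable fun e : ℕ => ‖1 / (n.1 j : ℂ) ^ (1 + t j) * (lam / n.1 j) ^ e‖ := by
    intro j
    simp only [norm_mul, norm_pow]
    exact (summable_geometric_of_lt_one (norm_nonneg _) (hlt j)).mul_left _
  refine (hasSum_antidiagonalTuple_prod _ _ hnorm hgeom).2.congr_fun fun w => ?_
  rw [Complex.ofReal_sum, Finset.sum_mul]
  refine Finset.sum_congr rfl fun ε hε => ?_
  rw [← Finset.Nat.mem_antidiagonalTuple.1 hε, ← Finset.prod_pow_eq_pow_sum, mzvTerm,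
    Complex.ofReal_prod, ← Finset.prod_mul_distrib]
  refine Finset.prod_congr rfl fun j _ => ?_
  have h1 := hn0 j
  simp only [Pi.add_apply]
  push_cast
  rw [div_pow, pow_add]
  field_simp

lemma ne_natCast_of_norm_lt_one {lam : ℂ} (h : ‖lam‖ < 1) (p : ℕ) (hp : 0 < p) :
    lam ≠ (p : ℂ) := by
  rintro rfl
  rw [Complex.norm_natCast] at h
  have : (1 : ℝ) ≤ p := by exact_mod_cast hp
  linarith

lemma hasSum_ohnoSum {r : ℕ} (t : Fin (r + 1) → ℕ) (h0 : 1 ≤ t 0) {lam : ℂ} (h : ‖lam‖ < 1) :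
    HasSum (fun w : ℕ => (ohnoSum (fun j => 1 + t j) w : ℂ) * lam ^ w)
      (∑' n, nestedTerm t lam n) := by
  set c : DecSeq (r + 1) → ℕ → ℝ := fun n w =>
    ∑ ε ∈ Finset.Nat.antidiagonalTuple (r + 1) w, mzvTerm ((fun j => 1 + t j) + ε) n with hc
  have hc0 : ∀ n w, 0 ≤ c n w := fun n w => Finset.sum_nonneg fun ε _ => mzvTerm_nonneg _ n
  have hfiber : ∀ n, HasSum (fun w => (c n w : ℂ) * lam ^ w) (nestedTerm t lam n) :=
    hasSum_nestedTerm t h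
  have hnorm : ‖((‖lam‖ : ℝ) : ℂ)‖ < 1 := by simpa using h
  have hreal : ∀ n, HasSum (fun w => c n w * ‖lam‖ ^ w) (weightTerm ‖lam‖ t n).toReal := by
    intro n
    have := hasSum_nestedTerm t hnorm n
    rw [nestedTerm_ofReal h] at this
    exact_mod_cast this
  -- Absolute convergence of the double series: its norms are its terms at `|lam|`.
  have hsum : Summable fun q : DecSeq (r + 1) × ℕ => (c q.1 q.2 : ℂ) * lam ^ q.2 := by
    refine Summable.of_norm ?_
    have heq : ∀ q : DecSeq (r + 1) × ℕ, ‖(c q.1 q.2 : ℂ) * lam ^ q.2‖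
        = c q.1 q.2 * ‖lam‖ ^ q.2 := fun q => by
      rw [norm_mul, norm_pow, Complex.norm_real, Real.norm_of_nonneg (hc0 _ _)]
    simp only [heq]
    rw [summable_prod_of_nonneg fun q => mul_nonneg (hc0 _ _) (by positivity)]
    refine ⟨fun n => (hreal n).summable, ?_⟩
    simp only [(hreal _).tsum_eq]
    have hs := summable_nestedTerm t h0 (ne_natCast_of_norm_lt_one hnorm)
    refine Complex.summable_ofReal.1 (hs.congr fun n => ?_)
    rw [nestedTerm_ofReal h]
  have htotal : HasSum (fun q : DecSeq (r + 1) × ℕ => (c q.1 q.2 : ℂ) * lam ^ q.2)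
      (∑' n, nestedTerm t lam n) := by
    have h1 := hsum.hasSum
    rwa [← (h1.prod_fiberwise hfiber).tsum_eq] at h1
  have hswap := (Equiv.prodComm ℕ (DecSeq (r + 1))).hasSum_iff.2 htotal
  refine hswap.prod_fiberwise fun w => ?_
  have hmzv : HasSum (fun n => c n w) (ohnoSum (fun j => 1 + t j) w) :=
    hasSum_sum fun ε _ => (summable_mzvTerm _ (by simp; omega) fun j => by simp; omega).hasSum
  exact (Complex.hasSum_ofReal.2 hmzv).mul_right (lam ^ w)

/-- Power series with equal sums in the unit disc have equal coefficients. -/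
lemma coeff_eq_of_hasSum {a b : ℕ → ℝ} {F : ℂ → ℂ}
    (ha : ∀ z : ℂ, ‖z‖ < 1 → HasSum (fun w => (a w : ℂ) * z ^ w) (F z))
    (hb : ∀ z : ℂ, ‖z‖ < 1 → HasSum (fun w => (b w : ℂ) * z ^ w) (F z)) : a = b := by
  have key : ∀ a : ℕ → ℝ, (∀ z : ℂ, ‖z‖ < 1 → HasSum (fun w => (a w : ℂ) * z ^ w) (F z)) →
      HasFPowerSeriesAt F (FormalMultilinearSeries.ofScalars ℂ fun w => (a w : ℂ)) 0 := by
    intro a ha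
    rw [hasFPowerSeriesAt_iff]
    filter_upwards [Metric.ball_mem_nhds (0 : ℂ) one_pos] with z hz
    simpa [FormalMultilinearSeries.coeff_ofScalars, mul_comm] using ha z (by simpa using hz)
  have heq := (key a ha).eq_formalMultilinearSeries (key b hb)
  ext w
  have hw := congrArg (fun p => FormalMultilinearSeries.coeff p w) heq
  simpa [FormalMultilinearSeries.coeff_ofScalars] using hw

/-! ### From real parameters to complex parameters and coefficients -/

/-- All analytic consequences of an identity between two of the series for real `lam < 1`. -/
lemma ohno_of_tsum_weightTerm_eq {r r' : ℕ} (hr : 0 < r) (hr' : 0 < r') (t : Fin r → ℕ)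
    (t' : Fin r' → ℕ) (h0 : 1 ≤ t ⟨0, hr⟩) (h0' : 1 ≤ t' ⟨0, hr'⟩)
    (heq : ∀ x : ℝ, x < 1 → ∑' n, weightTerm x t' n = ∑' n, weightTerm x t n) :
    (∀ lam : ℂ, (∀ p : ℕ, 0 < p → lam ≠ (p : ℂ)) →
      Summable (nestedTerm t lam) ∧ Summable (nestedTerm t' lam) ∧
      ∑' n, nestedTerm t lam n = ∑' n, nestedTerm t' lam n) ∧
    (∀ ε : Fin r → ℕ, Summable (mzvTerm ((fun j => 1 + t j) + ε))) ∧
    (∀ ε : Fin r' → ℕ, Summable (mzvTerm ((fun j => 1 + t' j) + ε))) ∧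
    (∀ lam : ℂ, ‖lam‖ < 1 →
      HasSum (fun w : ℕ => (ohnoSum (fun j => 1 + t j) w : ℂ) * lam ^ w)
        (∑' n, nestedTerm t lam n) ∧
      HasSum (fun w : ℕ => (ohnoSum (fun j => 1 + t' j) w : ℂ) * lam ^ w)
        (∑' n, nestedTerm t' lam n)) ∧
    ∀ w : ℕ, ohnoSum (fun j => 1 + t j) w = ohnoSum (fun j => 1 + t' j) w := by
  obtain ⟨r, rfl⟩ := Nat.exists_eq_succ_of_ne_zero hr.ne'
  obtain ⟨r', rfl⟩ := Nat.exists_eq_succ_of_ne_zero hr'.ne'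
  have hfin : ∀ {r : ℕ} (t : Fin r → ℕ) (x : ℝ) (n), weightTerm x t n ≠ ∞ := by
    intro r t x n
    exact (ENNReal.prod_lt_top fun j _ => ENNReal.mul_lt_top
      (ENNReal.pow_lt_top ENNReal.ofReal_lt_top) ENNReal.ofReal_lt_top).ne
  have htoReal : ∀ {r : ℕ} (t : Fin r → ℕ) (x : ℝ), x < 1 →
      ∑' n, nestedTerm t x n = ((∑' n, weightTerm x t n).toReal : ℂ) := by
    intro r t x hx
    rw [ENNReal.tsum_toReal_eq (hfin t x), Complex.ofReal_tsum]
    exact tsum_congr fun n => nestedTerm_ofReal hx t n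
  have hdual : ∀ lam : ℂ, (∀ p : ℕ, 0 < p → lam ≠ (p : ℂ)) →
      ∑' n, nestedTerm t lam n = ∑' n, nestedTerm t' lam n := fun lam h =>
    tsum_nestedTerm_eq_of_real t t' h0 h0'
      (fun x hx => by rw [htoReal t x hx, htoReal t' x hx, heq x hx]) h
  have hmzv : ∀ {r : ℕ} (t : Fin (r + 1) → ℕ), 1 ≤ t 0 → ∀ ε : Fin (r + 1) → ℕ,
      Summable (mzvTerm ((fun j => 1 + t j) + ε)) := fun t h0 ε =>
    summable_mzvTerm _ (by simp only [Pi.add_apply]; omega)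
      fun j => by simp only [Pi.add_apply]; omega
  refine ⟨fun lam h => ⟨summable_nestedTerm t h0 h, summable_nestedTerm t' h0' h, hdual lam h⟩,
    hmzv t h0, hmzv t' h0', fun lam h => ⟨hasSum_ohnoSum t h0 h, hasSum_ohnoSum t' h0' h⟩, ?_⟩
  refine congrFun (coeff_eq_of_hasSum (fun z hz => hasSum_ohnoSum t h0 hz) fun z hz => ?_)
  rw [hdual z (ne_natCast_of_norm_lt_one hz)]
  exact hasSum_ohnoSum t' h0' hz

lemma sum_pos_of_last {m : ℕ} (l : Fin (m + 1) → ℕ) (hl : 1 ≤ l (Fin.last m)) : 0 < ∑ i, l i :=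
  (Nat.zero_le _).trans_lt (partialLen_lt_sum l hl 0)

lemma one_le_xExponent_zero {m : ℕ} (k l : Fin (m + 1) → ℕ) (hk : 1 ≤ k 0) :
    1 ≤ xExponent k l 0 :=
  hk.trans (Finset.single_le_sum (f := k) (fun _ _ => Nat.zero_le _)
    (Finset.mem_filter.2 ⟨Finset.mem_univ 0, partialLen_zero l⟩))

lemma f_eq_tsum_nestedTerm {m : ℕ} (k l : Fin (m + 1) → ℕ) (hl : 1 ≤ l (Fin.last m)) (lam : ℂ) :
    f k l lam = ∑' n, nestedTerm (fun j : Fin (∑ i, l i) => xExponent k l j) lam n :=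
  tsum_congr (fTerm_eq_nestedTerm k l hl lam)

end OhnoRelation

open OhnoRelation in
theorem mainTheorem1 (m : ℕ) (k l : Fin (m + 1) → ℕ)
    (hk : 1 ≤ k 0) (hl : 1 ≤ l (Fin.last m)) :
    -- absolute convergence and equality of the generating functions off the positive integers
    (∀ lam : ℂ, (∀ p : ℕ, 0 < p → lam ≠ (p : ℂ)) →
      Summable (fTerm k l lam) ∧
      Summable (fTerm (dualK k l) (dualL k l) lam) ∧
      f k l lam = g k l lam) ∧
    -- convergence of the multiple zeta values that occur as coefficients
    (∀ ε : Fin (∑ i, l i) → ℕ, Summable (mzvTerm (zetaIndex k l + ε))) ∧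
    (∀ ε : Fin (∑ i, dualL k l i) → ℕ,
      Summable (mzvTerm (zetaIndex (dualK k l) (dualL k l) + ε))) ∧
    -- the power series expansions at the origin
    (∀ lam : ℂ, ‖lam‖ < 1 →
      HasSum (fun w : ℕ => (ohnoSum (zetaIndex k l) w : ℂ) * lam ^ w) (f k l lam) ∧
      HasSum (fun w : ℕ => (ohnoSum (zetaIndex (dualK k l) (dualL k l)) w : ℂ) * lam ^ w)
        (g k l lam)) ∧
    -- the relation among multiple zeta values obtained by equating coefficients
    (∀ w : ℕ, ohnoSum (zetaIndex k l) w = ohnoSum (zetaIndex (dualK k l) (dualL k l)) w) := by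
  have hl' := one_le_dualL_last k l hk
  obtain ⟨h1, h2, h3, h4, h5⟩ := ohno_of_tsum_weightTerm_eq (sum_pos_of_last l hl)
    (sum_pos_of_last (dualL k l) hl') (fun j => xExponent k l j)
    (fun j => xExponent (dualK k l) (dualL k l) j) (one_le_xExponent_zero k l hk)
    (one_le_xExponent_zero _ _ (one_le_dualK_zero k l hl))
    fun x hx => tsum_weightTerm_dual hx k l hk hl
  refine ⟨fun lam hlam => ?_, h2, h3, fun lam hlam => ?_, h5⟩
  · rw [g, f_eq_tsum_nestedTerm k l hl, f_eq_tsum_nestedTerm _ _ hl',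
      funext (fTerm_eq_nestedTerm k l hl lam), funext (fTerm_eq_nestedTerm _ _ hl' lam)]
    exact h1 lam hlam
  · rw [g, f_eq_tsum_nestedTerm k l hl, f_eq_tsum_nestedTerm _ _ hl']
    exact h4 lam hlam
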